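/- Let $s\ge 2$ be an integer and let $\mathbb Z_s=\varprojlim_n \mathbb Z/s^n\mathbb Z$ be the compact ring of $s$-adic integers. Let $\alpha:C(\mathbb Z_s)\to C(\mathbb Z_s)$ be the $*$-endomorphism $$(\alpha f)(x)=\begin{cases} f(x/s) & \text{if } s\mid x,\\ 0 & \text{otherwise.}\end{cases}$$ Let $HS(s)=C(\mathbb Z_s)\rtimes_\alpha\mathbb N$ be Stacey's crossed product, that is, the universal unital C$^*$-algebra generated by the image of a unital $*$-homomorphism $f\mapsto \mathsf M_f$ defined on $C(\mathbb Z_s)$ and an isometry $\mathsf V$, subject to the relations $\mathsf M_{\alpha(f)}=\mathsf V\,\mathsf M_f\,\mathsf V^*$ for all $f\in C(\mathbb Z_s)$. On $\ell^2(\mathbb Z)$ with canonical basis $(E_l)_{l\in\mathbb Z}$, let $V$ and $M_f$, $f\in C(\mathbb Z_s)$, be the bounded operators with $VE_l=E_{sl}$ and $M_fE_l=f(l)E_l$ for all $l\in\mathbb Z$, and let $C^*(V,M_f:f\in C(\mathbb Z_s))$ be the C$^*$-algebra of operators that they generate. Then there is an isomorphism of C$^*$-algebras $$HS(s)=C(\mathbb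 Z_s)\rtimes_\alpha\mathbb N\;\cong\; C^*(V,M_f:f\in C(\mathbb Z_s))$$ that maps $\mathsf V$ to $V$ and $\mathsf M_f$ to $M_f$ for every $f\in C(\mathbb Z_s)$. -/

import Mathlib

open scoped ENNReal

noncomputable section

/-! ## The ring of `s`-adic integers -/

/-- The ring `lim ℤ / s ^ n ℤ`, as a subring of the product of the rings `ℤ / s ^ n ℤ`. -/
def sAdicSubring (s : ℕ) : Subring (∀ n : ℕ, ZMod (s ^ n)) where
  carrier := {x | ∀ n, ZMod.castHom (pow_dvd_pow s n.le_succ) (ZMod (s ^ n)) (x (n + 1)) = x n}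
  mul_mem' hx hy n := by simp [-ZMod.castHom_apply, map_mul, hx n, hy n]
  one_mem' n := by simp [-ZMod.castHom_apply]
  add_mem' hx hy n := by simp [-ZMod.castHom_apply, map_add, hx n, hy n]
  zero_mem' n := by simp [-ZMod.castHom_apply]
  neg_mem' hx n := by simp [-ZMod.castHom_apply, map_neg, hx n]

/-- The ring `ℤ_s` of `s`-adic integers, with the topology induced by the product of the discrete
spaces `ℤ / s ^ n ℤ`. -/
abbrev SAdicInt (s : ℕ) : Type := sAdicSubring s

namespace SAdicInt

variable {s : ℕ}

theorem cast_succ (x : SAdicInt s) (n : ℕ) :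
    ZMod.castHom (pow_dvd_pow s n.le_succ) (ZMod (s ^ n)) (x.1 (n + 1)) = x.1 n := x.2 n

theorem continuous_coord (n : ℕ) : Continuous fun x : SAdicInt s => x.1 n :=
  (continuous_apply n).comp continuous_subtype_val

instance [NeZero s] : CompactSpace (SAdicInt s) := by
  have hc : IsClosed {x : ∀ n : ℕ, ZMod (s ^ n) |
      ∀ n, ZMod.castHom (pow_dvd_pow s n.le_succ) (ZMod (s ^ n)) (x (n + 1)) = x n} := by
    simp only [Set.ofPred_forall]
    refine isClosed_iInter fun n => isClosed_eq ?_ (continuous_apply n)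
    exact continuous_of_discreteTopology.comp (continuous_apply (n + 1))
  exact isCompact_iff_compactSpace.mp hc.isCompact

theorem val_succ_mod [NeZero s] (x : SAdicInt s) (n : ℕ) :
    (x.1 (n + 1)).val % s ^ n = (x.1 n).val := by
  have h := cast_succ x n
  rw [ZMod.castHom_apply, ← ZMod.natCast_val] at h
  rw [← h, ZMod.val_natCast]

/-- The map `x ↦ (x - x mod s) / s`; on multiples of `s` it is the division by `s`. -/
def divBase [NeZero s] (x : SAdicInt s) : SAdicInt s :=
  ⟨fun n => (((x.1 (n + 1)).val / s : ℕ) : ZMod (s ^ n)), fun n => by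
    have h1 : ∀ a : ℕ, a % s ^ (n + 1) / s = a / s % s ^ n := fun a => by
      rw [pow_succ', Nat.mod_mul_right_div_self]
    have h2 : (x.1 (n + 1)).val / s = (x.1 (n + 2)).val / s % s ^ n := by
      rw [← val_succ_mod x (n + 1), h1]
    change ZMod.castHom _ _ (((x.1 (n + 2)).val / s : ℕ) : ZMod (s ^ (n + 1))) =
      (((x.1 (n + 1)).val / s : ℕ) : ZMod (s ^ n))
    rw [map_natCast, h2, ZMod.natCast_mod]⟩

theorem continuous_divBase [NeZero s] : Continuous (divBase : SAdicInt s → SAdicInt s) := by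
  refine Continuous.subtype_mk (continuous_pi fun n => ?_) _
  exact (continuous_of_discreteTopology
    (f := fun a : ZMod (s ^ (n + 1)) => ((a.val / s : ℕ) : ZMod (s ^ n)))).comp
      (continuous_coord (n + 1))

theorem divBase_mul [NeZero s] (y : SAdicInt s) : divBase ((s : SAdicInt s) * y) = y := by
  apply Subtype.ext
  funext n
  have h1 : (((s : SAdicInt s) * y).1 (n + 1)) = ((s * (y.1 (n + 1)).val : ℕ) : ZMod _) := by
    push_cast
    simp
  change (((((s : SAdicInt s) * y).1 (n + 1)).val / s : ℕ) : ZMod (s ^ n)) = y.1 n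
  have h2 : ∀ a : ℕ, s * a % s ^ (n + 1) / s = a % s ^ n := fun a => by
    rw [pow_succ', Nat.mul_mod_mul_left, Nat.mul_div_cancel_left _ (NeZero.pos s)]
  rw [h1, ZMod.val_natCast, h2, val_succ_mod, ZMod.natCast_zmod_val]

theorem dvd_iff [NeZero s] (x : SAdicInt s) : (s : SAdicInt s) ∣ x ↔ x.1 1 = 0 := by
  constructor
  · rintro ⟨y, rfl⟩
    have : ((s : ℕ) : ZMod (s ^ 1)) = 0 := by
      rw [ZMod.natCast_eq_zero_iff]; simp
    simp [this]
  · intro hx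
    refine ⟨divBase x, Subtype.ext (funext fun n => ?_)⟩
    have hd : ∀ n, s ∣ (x.1 (n + 1)).val := by
      intro n
      induction n with
      | zero => simp [hx]
      | succ k ih =>
        rw [← val_succ_mod x (k + 1)] at ih
        exact (Nat.dvd_mod_iff (dvd_pow_self s k.succ_ne_zero)).mp ih
    change x.1 n = ((s : ℕ) : ZMod (s ^ n)) * (((x.1 (n + 1)).val / s : ℕ) : ZMod (s ^ n))
    rw [← Nat.cast_mul, Nat.mul_div_cancel' (hd n), ← ZMod.natCast_zmod_val (x.1 n),
      ← val_succ_mod x n, ZMod.natCast_mod]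

theorem mul_divBase [NeZero s] {x : SAdicInt s} (hx : (s : SAdicInt s) ∣ x) :
    (s : SAdicInt s) * divBase x = x := by
  obtain ⟨y, rfl⟩ := hx
  rw [divBase_mul]

theorem isClopen_dvd [NeZero s] : IsClopen {x : SAdicInt s | (s : SAdicInt s) ∣ x} := by
  have : {x : SAdicInt s | (s : SAdicInt s) ∣ x} = (fun x : SAdicInt s => x.1 1) ⁻¹' {0} := by
    ext x; exact dvd_iff x
  rw [this]
  exact (isClopen_discrete _).preimage (continuous_coord 1)

open Classical in
/-- The endomorphism `α` of `C(ℤ_s)`: `(α f)(x) = f (x / s)` if `s ∣ x`, and `0` otherwise. -/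
def alpha (s : ℕ) [NeZero s] : C(SAdicInt s, ℂ) →⋆ₙₐ[ℂ] C(SAdicInt s, ℂ) where
  toFun f :=
    { toFun := fun x => if (s : SAdicInt s) ∣ x then f (divBase x) else 0
      continuous_toFun := by
        refine Continuous.if (p := fun x : SAdicInt s => (s : SAdicInt s) ∣ x) (fun x hx => ?_)
          (f.continuous.comp continuous_divBase) continuous_const
        rw [isClopen_dvd.frontier_eq] at hx
        exact hx.elim }
  map_smul' c f := by ext x; simp
  map_zero' := by ext x; simp
  map_add' f g := by ext x; by_cases h : (s : SAdicInt s) ∣ x <;> simp [h]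
  map_mul' f g := by ext x; by_cases h : (s : SAdicInt s) ∣ x <;> simp [h]
  map_star' f := by ext x; by_cases h : (s : SAdicInt s) ∣ x <;> simp [h]

theorem alpha_apply_mul [NeZero s] (f : C(SAdicInt s, ℂ)) (y : SAdicInt s) :
    alpha s f ((s : SAdicInt s) * y) = f y := by
  refine (if_pos (dvd_mul_right _ _)).trans ?_
  rw [divBase_mul]

theorem alpha_apply_of_not_dvd [NeZero s] (f : C(SAdicInt s, ℂ)) {x : SAdicInt s}
    (hx : ¬ (s : SAdicInt s) ∣ x) : alpha s f x = 0 := if_neg hx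

end SAdicInt

/-! ## Stacey's crossed product by an endomorphism -/

universe u v

/-- A covariant pair for the endomorphism `α` of the unital C⋆-algebra `A`, in the unital
C⋆-algebra `B`: a unital `⋆`-homomorphism `M : A → B` and an isometry `V` in `B` such that
`M (α a) = V (M a) V⋆` for every `a`. -/
structure CovariantPair {A : Type u} [CStarAlgebra A] (α : A →⋆ₙₐ[ℂ] A)
    (B : Type v) [CStarAlgebra B] where
  M : A →⋆ₐ[ℂ] B
  V : B
  isometry : star V * V = 1
  covariant : ∀ a, M (α a) = V * M a * star V

namespace Stacey

variable {A : Type u} [CStarAlgebra A] (α : A →⋆ₙₐ[ℂ] A)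

/-- A non-zero unital C⋆-algebra together with a covariant pair in it. -/
structure Rep where
  B : Type u
  [cstar : CStarAlgebra B]
  [nontrivial : Nontrivial B]
  pair : CovariantPair α B

attribute [instance] Rep.cstar Rep.nontrivial

/-- The C⋆-algebra of all bounded families indexed by the covariant pairs of `α`. -/
abbrev BoundedFamily : Type (u + 1) := lp (fun π : Rep α => π.B) ∞

instance : CStarAlgebra (BoundedFamily α) where

/-- The direct sum of the maps `M` of all covariant pairs. -/
def sumM : A →⋆ₐ[ℂ] BoundedFamily α where
  toFun a := ⟨fun π => π.pair.M a, memℓp_infty ⟨‖a‖, by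
    rintro _ ⟨π, rfl⟩
    exact NonUnitalStarAlgHom.norm_apply_le π.pair.M a⟩⟩
  map_one' := lp.ext (funext fun π => map_one π.pair.M)
  map_mul' a b := lp.ext (funext fun π => map_mul π.pair.M a b)
  map_zero' := lp.ext (funext fun π => map_zero π.pair.M)
  map_add' a b := lp.ext (funext fun π => map_add π.pair.M a b)
  commutes' c := lp.ext (funext fun π => AlgHomClass.commutes π.pair.M c)
  map_star' a := lp.ext (funext fun π => map_star π.pair.M a)

/-- The direct sum of the isometries `V` of all covariant pairs. -/
def sumV : BoundedFamily α :=
  ⟨fun π => π.pair.V, memℓp_infty ⟨1, by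
    rintro _ ⟨π, rfl⟩
    have h := CStarRing.norm_star_mul_self (x := π.pair.V)
    rw [π.pair.isometry, norm_one] at h
    change ‖π.pair.V‖ ≤ 1
    nlinarith [norm_nonneg π.pair.V]⟩⟩

/-- The C⋆-algebra generated by the direct sum of all covariant pairs. -/
def subalgebra : StarSubalgebra ℂ (BoundedFamily α) :=
  (StarAlgebra.adjoin ℂ (insert (sumV α) (Set.range (sumM α)))).topologicalClosure

end Stacey

/-- Stacey's crossed product `A ⋊_α ℕ`: the universal unital C⋆-algebra generated by a unital
`⋆`-homomorphic image `M A` of `A` and an isometry `V` subject to `M (α a) = V (M a) V⋆`, realized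
as the C⋆-algebra generated by the direct sum of all covariant pairs. -/
def CrossedProduct {A : Type u} [CStarAlgebra A] (α : A →⋆ₙₐ[ℂ] A) : Type (u + 1) :=
  Stacey.subalgebra α

/-- A C⋆-algebra that is small for a universe has a copy in that universe. -/
theorem exists_starAlgEquiv_of_small (D : Type v) [CStarAlgebra D] [Small.{u} D] :
    ∃ (D' : Type u) (_ : CStarAlgebra D'), Nonempty (D' ≃⋆ₐ[ℂ] D) := by
  let e : Shrink.{u} D ≃ D := (equivShrink D).symm
  let : Ring (Shrink.{u} D) := e.ring
  let : Algebra ℂ (Shrink.{u} D) := e.algebra ℂ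
  let r : Shrink.{u} D ≃ₐ[ℂ] D := e.algEquiv ℂ
  let : NormedRing (Shrink.{u} D) :=
    NormedRing.induced (Shrink.{u} D) D r.toRingEquiv.toRingHom r.injective
  let : StarRing (Shrink.{u} D) :=
    { star := fun x => r.symm (star (r x))
      star_involutive := fun x => by simp
      star_mul := fun x y => by simp
      star_add := fun x y => by simp }
  have hstar : ∀ x, r (star x) = star (r x) := fun x => r.apply_symm_apply _
  have hnorm : ∀ x : Shrink.{u} D, ‖x‖ = ‖r x‖ := fun x => rfl
  let : NormedAlgebra ℂ (Shrink.{u} D) :=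
    { norm_smul_le := fun c x => by rw [hnorm, hnorm, map_smul]; exact norm_smul_le c _ }
  have : CStarRing (Shrink.{u} D) := ⟨fun x => by
    rw [hnorm, hnorm, map_mul, hstar, CStarRing.norm_star_mul_self]⟩
  have : StarModule ℂ (Shrink.{u} D) := ⟨fun c x => r.injective (by
    rw [hstar, map_smul, map_smul, hstar, star_smul])⟩
  have hiso : Isometry r := AddMonoidHomClass.isometry_of_norm r fun x => rfl
  have : CompleteSpace (Shrink.{u} D) :=
    (completeSpace_congr (e := r.toEquiv) hiso.isUniformEmbedding).mpr inferInstance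
  exact ⟨Shrink.{u} D, { }, ⟨StarAlgEquiv.ofAlgEquiv r hstar⟩⟩

namespace CovariantPair

variable {A : Type u} [CStarAlgebra A] {α : A →⋆ₙₐ[ℂ] A} {B : Type v} [CStarAlgebra B]

/-- The C⋆-algebra generated by a covariant pair. -/
def generated (P : CovariantPair α B) : StarSubalgebra ℂ B :=
  (StarAlgebra.adjoin ℂ (insert P.V (Set.range P.M))).topologicalClosure

instance (P : CovariantPair α B) : IsClosed (P.generated : Set B) :=
  StarSubalgebra.isClosed_topologicalClosure _

theorem small_generated (P : CovariantPair α B) : Small.{u} P.generated := by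
  let g : Option (Option A) → B := fun x => x.elim (star P.V) fun y => y.elim P.V P.M
  have hg : insert P.V (Set.range P.M) ∪ star (insert P.V (Set.range P.M)) ⊆ Set.range g := by
    rintro x ((rfl | ⟨a, rfl⟩) | hx)
    · exact ⟨some none, rfl⟩
    · exact ⟨some (some a), rfl⟩
    · rcases hx with hx | ⟨a, ha⟩
      · exact ⟨none, by rw [← star_star x, hx]; rfl⟩
      · exact ⟨some (some (star a)), by
          change P.M (star a) = x
          rw [map_star, ha, star_star]⟩
  let S : Set B := Set.range (FreeAlgebra.lift ℂ g)
  have hS : (StarAlgebra.adjoin ℂ (insert P.V (Set.range P.M)) : Set B) ⊆ S := by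
    intro x hx
    have h1 : x ∈ Algebra.adjoin ℂ (Set.range g) := Algebra.adjoin_mono hg hx
    rw [Algebra.adjoin_range_eq_range_freeAlgebra_lift] at h1
    exact h1
  let lim : (ℕ → S) → B := fun q => Filter.atTop.limUnder fun n => (q n : B)
  have hlim : (P.generated : Set B) ⊆ Set.range lim := by
    intro x hx
    obtain ⟨q, hq, hx⟩ := mem_closure_iff_seq_limit.mp hx
    exact ⟨fun n => ⟨q n, hS (hq n)⟩, hx.limUnder_eq⟩
  exact small_subset hlim

/-- A covariant pair, seen in the C⋆-algebra that it generates. -/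
def restrict (P : CovariantPair α B) : CovariantPair α P.generated where
  M := P.M.codRestrict P.generated fun a =>
    StarSubalgebra.le_topologicalClosure _ (StarAlgebra.subset_adjoin ℂ _ (Or.inr ⟨a, rfl⟩))
  V := ⟨P.V, StarSubalgebra.le_topologicalClosure _ (StarAlgebra.subset_adjoin ℂ _ (Or.inl rfl))⟩
  isometry := Subtype.ext P.isometry
  covariant a := Subtype.ext (P.covariant a)

/-- The image of a covariant pair under a unital `⋆`-homomorphism. -/
def map {C : Type*} [CStarAlgebra C] (P : CovariantPair α B) (φ : B →⋆ₐ[ℂ] C) :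
    CovariantPair α C where
  M := φ.comp P.M
  V := φ P.V
  isometry := by rw [← map_star, ← map_mul, P.isometry, map_one]
  covariant a := by
    rw [StarAlgHom.comp_apply, StarAlgHom.comp_apply, P.covariant, map_mul, map_mul, map_star]

end CovariantPair

namespace CrossedProduct

variable {A : Type u} [CStarAlgebra A] (α : A →⋆ₙₐ[ℂ] A)

instance : CStarAlgebra (CrossedProduct α) :=
  StarSubalgebra.cstarAlgebra (Stacey.subalgebra α)
    (h_closed := StarSubalgebra.isClosed_topologicalClosure _)

/-- The canonical covariant pair in the crossed product. -/
def pair : CovariantPair α (CrossedProduct α) where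
  M := (Stacey.sumM α).codRestrict (Stacey.subalgebra α) fun a =>
    StarSubalgebra.le_topologicalClosure _ (StarAlgebra.subset_adjoin ℂ _ (Or.inr ⟨a, rfl⟩))
  V := ⟨Stacey.sumV α,
    StarSubalgebra.le_topologicalClosure _ (StarAlgebra.subset_adjoin ℂ _ (Or.inl rfl))⟩
  isometry := Subtype.ext (lp.ext (funext fun π => π.pair.isometry))
  covariant a := Subtype.ext (lp.ext (funext fun π => π.pair.covariant a))

variable {α}

/-- Two homomorphisms on the crossed product agree if they agree on the generators. -/
theorem hom_ext {B : Type v} [CStarAlgebra B] {φ ψ : CrossedProduct α →⋆ₐ[ℂ] B}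
    (hM : ∀ a, φ ((pair α).M a) = ψ ((pair α).M a)) (hV : φ (pair α).V = ψ (pair α).V) :
    φ = ψ := by
  let φ' : Stacey.subalgebra α →⋆ₐ[ℂ] B := φ
  let ψ' : Stacey.subalgebra α →⋆ₐ[ℂ] B := ψ
  have hφ : Continuous φ' :=
    AddMonoidHomClass.continuous_of_bound φ 1 fun x => by
      rw [one_mul]; exact NonUnitalStarAlgHom.norm_apply_le φ x
  have hψ : Continuous ψ' :=
    AddMonoidHomClass.continuous_of_bound ψ 1 fun x => by
      rw [one_mul]; exact NonUnitalStarAlgHom.norm_apply_le ψ x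
  change φ' = ψ'
  refine StarAlgHom.ext_topologicalClosure hφ hψ (StarAlgHom.ext_adjoin ?_)
  rintro ⟨x, _⟩ (rfl | ⟨a, rfl⟩)
  · exact hV
  · exact hM a

/-- The evaluation of the crossed product at a covariant pair in the universe of `A`. -/
def eval (π : Stacey.Rep α) : CrossedProduct α →⋆ₐ[ℂ] π.B where
  toFun x := x.1 π
  map_one' := rfl
  map_mul' _ _ := rfl
  map_zero' := rfl
  map_add' _ _ := rfl
  commutes' _ := rfl
  map_star' _ := rfl

/-- The universal property of the crossed product, for C⋆-algebras in any universe. -/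
theorem existsUnique_hom {B : Type v} [CStarAlgebra B] (P : CovariantPair α B) :
    ∃! φ : CrossedProduct α →⋆ₐ[ℂ] B, (∀ a, φ ((pair α).M a) = P.M a) ∧ φ (pair α).V = P.V := by
  refine existsUnique_of_exists_of_unique ?_ fun φ ψ hφ hψ =>
    hom_ext (fun a => (hφ.1 a).trans (hψ.1 a).symm) (hφ.2.trans hψ.2.symm)
  have := P.small_generated
  obtain ⟨D, hD, ⟨e⟩⟩ := exists_starAlgEquiv_of_small.{u} P.generated
  let f : D →⋆ₐ[ℂ] B := P.generated.subtype.comp (e : D →⋆ₐ[ℂ] P.generated)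
  let Q : CovariantPair α D := P.restrict.map (e.symm : P.generated →⋆ₐ[ℂ] D)
  have hQM : ∀ a, f (Q.M a) = P.M a := fun a =>
    congrArg Subtype.val (e.apply_symm_apply (P.restrict.M a))
  have hQV : f Q.V = P.V := congrArg Subtype.val (e.apply_symm_apply P.restrict.V)
  rcases subsingleton_or_nontrivial D with hs | hn
  · have h10 : (1 : B) = 0 := by rw [← map_one f, Subsingleton.elim (1 : D) 0, map_zero]
    have hB : ∀ x y : B, x = y := fun x y => by rw [← mul_one x, ← mul_one y, h10, mul_zero, mul_zero]
    exact ⟨{ toFun := fun _ => 0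
             map_one' := hB _ _
             map_mul' := fun _ _ => hB _ _
             map_zero' := rfl
             map_add' := fun _ _ => hB _ _
             commutes' := fun _ => hB _ _
             map_star' := fun _ => hB _ _ }, fun _ => hB _ _, hB _ _⟩
  · exact ⟨f.comp (eval { B := D, pair := Q }), hQM, hQV⟩

end CrossedProduct

/-! ## The concrete algebra on `ℓ²(ℤ)` -/

namespace SAdicInt

/-- The Hilbert space `ℓ²(ℤ)`. -/
abbrev ellTwo : Type := lp (fun _ : ℤ => ℂ) 2

/-- The canonical basis vectors `E_l` of `ℓ²(ℤ)`. -/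
def basisVec (l : ℤ) : ellTwo := lp.single 2 l 1

theorem orthonormal_basisVec : Orthonormal ℂ basisVec := by
  classical
  rw [orthonormal_iff_ite]
  intro i j
  rw [basisVec, basisVec, lp.inner_single_left]
  by_cases h : i = j
  · subst h; simp
  · simp [h]

variable (s : ℕ) [NeZero s]

theorem orthonormal_basisVec_mul : Orthonormal ℂ fun l : ℤ => basisVec (s * l) :=
  orthonormal_basisVec.comp _
    (mul_right_injective₀ (Int.natCast_ne_zero.mpr (NeZero.ne s)))

/-- The `s`-adic shift: the bounded operator with `V E_l = E_{s l}`. -/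
def shift : ellTwo →L[ℂ] ellTwo :=
  (orthonormal_basisVec_mul s).orthogonalFamily.linearIsometry.toContinuousLinearMap

theorem shift_basisVec (l : ℤ) : shift s (basisVec l) = basisVec (s * l) := by
  have h := (orthonormal_basisVec_mul s).orthogonalFamily.linearIsometry_apply_single (i := l)
    (1 : ℂ)
  rw [LinearIsometry.toSpanSingleton_apply, one_smul] at h
  exact h

variable {s}

theorem norm_mul_coord_le (f : C(SAdicInt s, ℂ)) (ξ : ellTwo) (l : ℤ) :
    ‖f (l : SAdicInt s) * ξ l‖ ≤ ‖((‖f‖ : ℂ) • ξ) l‖ := by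
  rw [lp.coeFn_smul, Pi.smul_apply, smul_eq_mul, norm_mul, norm_mul, Complex.norm_real, norm_norm]
  exact mul_le_mul_of_nonneg_right (f.norm_coe_le_norm _) (norm_nonneg _)

/-- The multiplication by the sequence `f(l)`, as a linear map on `ℓ²(ℤ)`. -/
def mulLin (f : C(SAdicInt s, ℂ)) : ellTwo →ₗ[ℂ] ellTwo where
  toFun ξ := ⟨fun l => f (l : SAdicInt s) * ξ l,
    (lp.memℓp ((‖f‖ : ℂ) • ξ)).mono' (norm_mul_coord_le f ξ)⟩
  map_add' _ _ := lp.ext (funext fun _ => mul_add _ _ _)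
  map_smul' _ _ := lp.ext (funext fun _ => mul_left_comm _ _ _)

/-- The multiplication operator `M_f`, with `(M_f ξ)(l) = f(l) ξ(l)`. -/
def mulOp (f : C(SAdicInt s, ℂ)) : ellTwo →L[ℂ] ellTwo :=
  (mulLin f).mkContinuous ‖f‖ fun ξ => by
    refine (lp.norm_mono two_ne_zero (norm_mul_coord_le f ξ)).trans ?_
    rw [norm_smul, Complex.norm_real, norm_norm]

theorem mulOp_apply (f : C(SAdicInt s, ℂ)) (ξ : ellTwo) (l : ℤ) :
    mulOp f ξ l = f (l : SAdicInt s) * ξ l := rfl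

theorem mulOp_basisVec (f : C(SAdicInt s, ℂ)) (l : ℤ) :
    mulOp f (basisVec l) = f (l : SAdicInt s) • basisVec l := by
  refine lp.ext (funext fun k => ?_)
  rw [mulOp_apply, lp.coeFn_smul, Pi.smul_apply, smul_eq_mul]
  by_cases h : k = l
  · rw [h]
  · rw [basisVec, lp.single_apply_ne _ _ _ h, mul_zero, mul_zero]

variable (s)

/-- The C⋆-algebra `C⋆(V, M_f : f ∈ C(ℤ_s))` of operators on `ℓ²(ℤ)`. -/
def concreteAlgebra : StarSubalgebra ℂ (ellTwo →L[ℂ] ellTwo) :=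
  (StarAlgebra.adjoin ℂ (insert (shift s) (Set.range (mulOp (s := s))))).topologicalClosure

instance : CStarAlgebra (concreteAlgebra s) :=
  StarSubalgebra.cstarAlgebra (concreteAlgebra s)
    (h_closed := StarSubalgebra.isClosed_topologicalClosure _)

/-- The Hensel-Steinitz algebra `HS(s) = C(ℤ_s) ⋊_α ℕ`. -/
abbrev HenselSteinitz : Type 1 := CrossedProduct (alpha s)

theorem shift_mem : shift s ∈ concreteAlgebra s :=
  StarSubalgebra.le_topologicalClosure _ (StarAlgebra.subset_adjoin ℂ _ (Or.inl rfl))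

theorem mulOp_mem (f : C(SAdicInt s, ℂ)) : mulOp f ∈ concreteAlgebra s :=
  StarSubalgebra.le_topologicalClosure _ (StarAlgebra.subset_adjoin ℂ _ (Or.inr ⟨f, rfl⟩))

end SAdicInt

end

/-! The universal property gives `toConcrete`, and its range contains the generators, so everything
rests on injectivity. The argument is a gauge-invariant uniqueness argument in which finite averages
replace integration over the circle. Words `M_f V ^ n` and `V⋆ ^ n M_f` span a dense subspace
(`mem_closure_span_words`). Averaging the gauge action over the `N`-th roots of unity kills the
words of degree `n > 0` once `N > n`. Hence an element of the span is eventually averaged to some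
`M_f`, and for `l ≠ 0` the value `f(l)` is the diagonal coefficient at `E_l` of its image on `ℓ²(ℤ)`
(`exists_gaugeMean_eq`). Non-zero integers are dense in `ℤ_s`, so the norm of `f` is bounded by the
norm of that image. The point `l = 0` is avoided because `V` fixes `E_0`. Faithfulness of the
conditional expectation is replaced by `exists_norm_le_gaugeMean_star_mul_self`: the means of `star
x * x` over `m * K` roots stay above `‖star x * x‖ / (2 * m)`, with `m` independent of `K`. If `x`
is in the kernel, approximating `star x * x` by a combination of words makes such a mean too small,
unless `x = 0`. -/

noncomputable section

/-! ### Gauge action and its means over roots of unity. -/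

/-- If the first `K` of `N` positive elements `(x k)⋆ x k` are close to `y`, then the norm of the sum
of all of them is bounded below. -/
theorem mul_norm_le_norm_sum_star_mul_self {B : Type v} [CStarAlgebra B] {x : ℕ → B} {y : B}
    {K N : ℕ} (hKN : K ≤ N) (h : ∀ k ∈ Finset.range K, ‖y - star (x k) * x k‖ ≤ ‖y‖ / 2) :
    K * (‖y‖ / 2) ≤ ‖∑ k ∈ Finset.range N, star (x k) * x k‖ := by
  let _ := CStarAlgebra.spectralOrder B
  let _ := CStarAlgebra.spectralOrderedRing B
  have hle : ∑ k ∈ Finset.range K, star (x k) * x k ≤ ∑ k ∈ Finset.range N, star (x k) * x k :=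
    Finset.sum_le_sum_of_subset_of_nonneg (Finset.range_subset_range.mpr hKN)
      fun k _ _ => star_mul_self_nonneg (x k)
  refine le_trans ?_ (CStarAlgebra.norm_le_norm_of_nonneg_of_le
    (Finset.sum_nonneg fun k _ => star_mul_self_nonneg (x k)) hle)
  have h1 : ‖∑ k ∈ Finset.range K, (y - star (x k) * x k)‖ ≤ K * (‖y‖ / 2) := by
    refine (norm_sum_le_of_le _ h).trans ?_
    simp
  rw [Finset.sum_sub_distrib, Finset.sum_const, Finset.card_range] at h1
  have h2 : ‖K • y‖ = K * ‖y‖ := by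
    rw [← Nat.cast_smul_eq_nsmul ℂ, norm_smul, Complex.norm_natCast]
  have h3 := norm_sub_norm_le (K • y) (∑ k ∈ Finset.range K, star (x k) * x k)
  linarith

namespace CrossedProduct

variable {A : Type u} [CStarAlgebra A] {α : A →⋆ₙₐ[ℂ] A}

/-- The homomorphism of a covariant pair takes its values in each closed `⋆`-subalgebra that contains
the pair. -/
theorem exists_hom_mem_of_isClosed {B : Type v} [CStarAlgebra B] (P : CovariantPair α B)
    (S : StarSubalgebra ℂ B) (hS : IsClosed (S : Set B)) (hM : ∀ a, P.M a ∈ S) (hV : P.V ∈ S) :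
    ∃ φ : CrossedProduct α →⋆ₐ[ℂ] B,
      ((∀ a, φ ((pair α).M a) = P.M a) ∧ φ (pair α).V = P.V) ∧ ∀ x, φ x ∈ S := by
  have : IsClosed (S : Set B) := hS
  let Q : CovariantPair α S :=
    { M := P.M.codRestrict S hM
      V := ⟨P.V, hV⟩
      isometry := Subtype.ext P.isometry
      covariant := fun a => Subtype.ext (P.covariant a) }
  obtain ⟨φ, ⟨hφM, hφV⟩, -⟩ := existsUnique_hom Q
  exact ⟨S.subtype.comp φ, ⟨fun a => congrArg Subtype.val (hφM a), congrArg Subtype.val hφV⟩,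
    fun x => (φ x).2⟩

/-- A closed `⋆`-subalgebra of the crossed product that contains the generators is everything. -/
theorem mem_of_isClosed (S : StarSubalgebra ℂ (CrossedProduct α))
    (hS : IsClosed (S : Set (CrossedProduct α))) (hM : ∀ a, (pair α).M a ∈ S)
    (hV : (pair α).V ∈ S) (x : CrossedProduct α) : x ∈ S := by
  obtain ⟨φ, ⟨hφM, hφV⟩, hφ⟩ := exists_hom_mem_of_isClosed (pair α) S hS hM hV
  -- The universal map into `S`, followed by the inclusion, fixes the generators, so it is the
  -- identity.
  have h : φ = StarAlgHom.id ℂ (CrossedProduct α) := hom_ext hφM hφV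
  have hx := hφ x
  rwa [h] at hx

variable (α) in
/-- The covariant pair in the crossed product whose isometry is rotated by `z`. -/
def rotatedPair (z : Circle) : CovariantPair α (CrossedProduct α) where
  M := (pair α).M
  V := (z : ℂ) • (pair α).V
  isometry := by
    rw [star_smul, smul_mul_smul_comm, (pair α).isometry]
    simp [← Circle.coe_inv_eq_conj]
  covariant a := by
    rw [star_smul, smul_mul_assoc, smul_mul_smul_comm, (pair α).covariant]
    simp [← Circle.coe_inv_eq_conj]

/-- The gauge action of the circle on the crossed product. -/
def gauge (z : Circle) : CrossedProduct α →⋆ₐ[ℂ] CrossedProduct α :=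
  (existsUnique_hom (rotatedPair α z)).choose

theorem gauge_M (z : Circle) (a : A) : gauge z ((pair α).M a) = (pair α).M a :=
  (existsUnique_hom (rotatedPair α z)).choose_spec.1.1 a

theorem gauge_V (z : Circle) : gauge z (pair α).V = (z : ℂ) • (pair α).V :=
  (existsUnique_hom (rotatedPair α z)).choose_spec.1.2

theorem norm_gauge_le (z : Circle) (y : CrossedProduct α) : ‖gauge z y‖ ≤ ‖y‖ :=
  NonUnitalStarAlgHom.norm_apply_le (gauge z) y

theorem gauge_one (y : CrossedProduct α) : gauge 1 y = y := by
  have h : gauge 1 = StarAlgHom.id ℂ (CrossedProduct α) :=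
    hom_ext (gauge_M 1) (by rw [gauge_V]; simp)
  rw [h]
  rfl

/-- Elements with continuous orbit form a `⋆`-subalgebra containing the generators. It is closed
because every `gauge z` is contractive: approximating `y` approximates its orbit uniformly in `z`.
-/
theorem continuous_gauge (y : CrossedProduct α) : Continuous fun z => gauge z y := by
  let S : StarSubalgebra ℂ (CrossedProduct α) :=
    { carrier := {y | Continuous fun z => gauge z y}
      mul_mem' := fun {a b} ha hb => by
        simp only [Set.mem_ofPred_eq, map_mul] at ha hb ⊢
        exact ha.mul hb
      add_mem' := fun {a b} ha hb => by
        simp only [Set.mem_ofPred_eq, map_add] at ha hb ⊢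
        exact ha.add hb
      algebraMap_mem' := fun c => by
        simpa only [Set.mem_ofPred_eq, AlgHomClass.commutes] using continuous_const
      star_mem' := fun {a} ha => by
        simpa only [Set.mem_ofPred_eq, map_star] using Continuous.star ha }
  have hS : IsClosed (S : Set (CrossedProduct α)) := by
    refine isClosed_of_closure_subset fun y hy => ?_
    refine continuous_of_uniform_approx_of_continuous fun u hu => ?_
    obtain ⟨ε, hε, hu⟩ := Metric.mem_uniformity_dist.mp hu
    obtain ⟨y', hy', h⟩ := Metric.mem_closure_iff.mp hy ε hε
    refine ⟨fun z => gauge z y', hy', fun z => hu ?_⟩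
    rw [dist_eq_norm, ← map_sub]
    exact (norm_gauge_le z _).trans_lt (by rwa [← dist_eq_norm])
  exact mem_of_isClosed S hS
    (fun a => by
      change Continuous fun z => gauge z ((pair α).M a)
      simpa only [gauge_M] using continuous_const)
    (by
      change Continuous fun z => gauge z (pair α).V
      simp only [gauge_V]
      fun_prop) y

/-- The average of the gauge action over the `N`-th roots of unity. -/
def gaugeMean (N : ℕ) : CrossedProduct α →ₗ[ℂ] CrossedProduct α :=
  (N : ℂ)⁻¹ • ∑ k ∈ Finset.range N,
    (gauge (Circle.exp (2 * Real.pi * k / N)) : CrossedProduct α →⋆ₐ[ℂ] _).toAlgHom.toLinearMap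

theorem gaugeMean_apply (N : ℕ) (y : CrossedProduct α) :
    gaugeMean N y =
      (N : ℂ)⁻¹ • ∑ k ∈ Finset.range N, gauge (Circle.exp (2 * Real.pi * k / N)) y := by
  simp [gaugeMean]

theorem norm_gaugeMean_le (N : ℕ) (y : CrossedProduct α) : ‖gaugeMean N y‖ ≤ ‖y‖ := by
  rcases N.eq_zero_or_pos with rfl | hN
  · simp [gaugeMean_apply]
  have hN' : (0 : ℝ) < N := Nat.cast_pos.mpr hN
  rw [gaugeMean_apply, norm_smul, norm_inv, Complex.norm_natCast, inv_mul_le_iff₀ hN']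
  refine (norm_sum_le_of_le _ fun k _ => norm_gauge_le _ y).trans ?_
  simp

theorem gaugeMean_eq_self {N : ℕ} (hN : 0 < N) {y : CrossedProduct α}
    (hy : ∀ z, gauge z y = y) : gaugeMean N y = y := by
  have hN' : (N : ℂ) ≠ 0 := Nat.cast_ne_zero.mpr hN.ne'
  simp only [gaugeMean_apply, hy, Finset.sum_const, Finset.card_range]
  rw [← Nat.cast_smul_eq_nsmul ℂ, smul_smul, inv_mul_cancel₀ hN', one_smul]

theorem gaugeMean_star (N : ℕ) (y : CrossedProduct α) :
    gaugeMean N (star y) = star (gaugeMean N y) := by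
  simp [gaugeMean_apply, map_star]

/-- The mean is a geometric sum with ratio `ζ ^ n`, where `ζ` is a primitive `N`-th root of unity.
Since `0 < n < N`, the ratio differs from `1`, while its `N`-th power is `1`. -/
theorem gaugeMean_eq_zero {N n : ℕ} (hn : 0 < n) (hN : n < N) {y : CrossedProduct α}
    (hy : ∀ z : Circle, gauge z y = (z : ℂ) ^ n • y) : gaugeMean N y = 0 := by
  have hN0 : N ≠ 0 := by omega
  have hζ := Complex.isPrimitiveRoot_exp N hN0
  have hterm : ∀ k : ℕ, ((Circle.exp (2 * Real.pi * k / N) : Circle) : ℂ) ^ n =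
      (Complex.exp (2 * Real.pi * Complex.I / N) ^ n) ^ k := fun k => by
    rw [Circle.coe_exp, pow_right_comm, ← Complex.exp_nat_mul _ k]
    congr 2
    push_cast
    ring
  simp only [gaugeMean_apply, hy, hterm]
  rw [← Finset.sum_smul]
  have h1 : Complex.exp (2 * Real.pi * Complex.I / N) ^ n ≠ 1 := hζ.pow_ne_one_of_pos_of_lt hn.ne' hN
  rw [geom_sum_eq h1, ← pow_mul, mul_comm n N, pow_mul, hζ.pow_eq_one, one_pow, sub_self,
    zero_div, zero_smul, smul_zero]

/-- The gauge means of a positive element are bounded below in norm along a sequence. -/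
theorem exists_norm_le_gaugeMean_star_mul_self (x : CrossedProduct α) :
    ∃ m : ℕ, 0 < m ∧ ∀ K : ℕ, 0 < K →
      ‖star x * x‖ / 2 ≤ m * ‖gaugeMean (m * K) (star x * x)‖ := by
  set y := star x * x with hy
  rcases eq_or_ne y 0 with h0 | h0
  · exact ⟨1, one_pos, fun K _ => by simp [h0]⟩
  have hc : Continuous fun t : ℝ => gauge (Circle.exp t) y :=
    (continuous_gauge y).comp Circle.exp.continuous
  obtain ⟨δ, hδ, hclose⟩ := Metric.continuous_iff.mp hc 0 (‖y‖ / 2) (by positivity)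
  -- For every `K`, the first `K` of the `m * K` roots have angles below `2π / m < δ`, so they move
  -- `y` by less than `‖y‖ / 2`. These are a fraction `1 / m` of all the roots.
  obtain ⟨m, hm⟩ := exists_nat_gt (2 * Real.pi / δ)
  have hm0 : (0 : ℝ) < m := lt_trans (by positivity) hm
  have hm1 : 1 ≤ m := Nat.cast_pos.mp hm0
  refine ⟨m, hm1, fun K hK => ?_⟩
  have hK0 : (0 : ℝ) < K := Nat.cast_pos.mpr hK
  let t : ℕ → Circle := fun k => Circle.exp (2 * Real.pi * k / (m * K : ℕ))
  have hnear : ∀ k ∈ Finset.range K, ‖y - star (gauge (t k) x) * gauge (t k) x‖ ≤ ‖y‖ / 2 := by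
    intro k hk
    have hk' : (k : ℝ) < K := Nat.cast_lt.mpr (Finset.mem_range.mp hk)
    have h := hclose (2 * Real.pi * k / (m * K : ℕ)) (by
      rw [dist_zero_right, Real.norm_of_nonneg (by positivity), Nat.cast_mul,
        div_lt_iff₀ (by positivity)]
      rw [div_lt_iff₀ hδ] at hm
      calc 2 * Real.pi * k ≤ 2 * Real.pi * K := by gcongr
        _ < m * δ * K := by gcongr
        _ = δ * (m * K) := by ring)
    rw [dist_comm, dist_eq_norm, Circle.exp_zero, gauge_one] at h
    rw [← map_star, ← map_mul]
    exact h.le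
  have hlow := mul_norm_le_norm_sum_star_mul_self (Nat.le_mul_of_pos_left K hm1) hnear
  have hmean : ‖gaugeMean (m * K) y‖ =
      ((m : ℝ) * K)⁻¹ * ‖∑ k ∈ Finset.range (m * K), star (gauge (t k) x) * gauge (t k) x‖ := by
    rw [gaugeMean_apply, norm_smul, norm_inv, Complex.norm_natCast, Nat.cast_mul]
    simp only [← map_star, ← map_mul, t, hy, Nat.cast_mul]
  calc ‖y‖ / 2 = (K * (‖y‖ / 2)) / K := by field_simp
    _ ≤ ‖∑ k ∈ Finset.range (m * K), star (gauge (t k) x) * gauge (t k) x‖ / K := by gcongr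
    _ = m * ‖gaugeMean (m * K) y‖ := by
      rw [hmean]
      field_simp

end CrossedProduct

end

noncomputable section

/-! ### The covariant pair on `ℓ²(ℤ)` and density of the non-zero integers. -/

namespace SAdicInt

variable {s : ℕ} [NeZero s]

theorem dvd_intCast_iff (l : ℤ) : (s : SAdicInt s) ∣ (l : SAdicInt s) ↔ (s : ℤ) ∣ l := by
  rw [dvd_iff]
  change ((l : ℤ) : ZMod (s ^ 1)) = 0 ↔ _
  rw [ZMod.intCast_zmod_eq_zero_iff_dvd, pow_one]

theorem ext_basisVec {S T : ellTwo →L[ℂ] ellTwo}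
    (h : ∀ l, S (basisVec l) = T (basisVec l)) : S = T := by
  refine lp.ext_continuousLinearMap (ENNReal.ofNat_ne_top (n := nat_lit 2)) fun l => ?_
  refine ContinuousLinearMap.ext_ring ?_
  exact h l

theorem inner_basisVec (l : ℤ) (ξ : ellTwo) : inner ℂ (basisVec l) ξ = ξ l := by
  rw [basisVec, lp.inner_single_left]
  simp

theorem star_shift_mul_shift : star (shift s) * shift s = 1 := by
  refine ContinuousLinearMap.ext fun ξ => ext_inner_left ℂ fun η => ?_
  rw [ContinuousLinearMap.star_eq_adjoint, mul_apply_eq_comp,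
    ContinuousLinearMap.adjoint_inner_right]
  exact LinearIsometry.inner_map_map _ _ _

theorem star_shift_basisVec_of_not_dvd {l : ℤ} (hl : ¬ (s : ℤ) ∣ l) :
    star (shift s) (basisVec l) = 0 := by
  refine lp.ext (funext fun k => ?_)
  rw [← inner_basisVec, ContinuousLinearMap.star_eq_adjoint,
    ContinuousLinearMap.adjoint_inner_right, shift_basisVec, orthonormal_basisVec.2]
  · rfl
  · rintro rfl
    exact hl (dvd_mul_right _ _)

theorem mulOp_star (f : C(SAdicInt s, ℂ)) : mulOp (star f) = star (mulOp f) := by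
  refine ext_basisVec fun l => lp.ext (funext fun k => ?_)
  rw [← inner_basisVec k (star (mulOp f) _), ContinuousLinearMap.star_eq_adjoint,
    ContinuousLinearMap.adjoint_inner_right, mulOp_basisVec f k,
    inner_smul_left, inner_basisVec, mulOp_apply]
  by_cases h : k = l
  · subst h; rfl
  · rw [basisVec, lp.single_apply_ne _ _ _ h, mul_zero, mul_zero]

/-- On `E_l` with `l = s * k` both sides act as `f(k)`. If `s` does not divide `l`, then `V⋆` kills
`E_l` and `α f` vanishes at `l`. -/
theorem mulOp_alpha (f : C(SAdicInt s, ℂ)) :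
    mulOp (alpha s f) = shift s * mulOp f * star (shift s) := by
  refine ext_basisVec fun l => ?_
  rw [mulOp_basisVec, mul_apply_eq_comp, mul_apply_eq_comp]
  by_cases hl : (s : ℤ) ∣ l
  · obtain ⟨k, rfl⟩ := hl
    have h1 : star (shift s) (basisVec (s * k)) = basisVec k := by
      rw [← shift_basisVec, ← mul_apply_eq_comp, star_shift_mul_shift,
        one_apply_eq_self]
    rw [h1, mulOp_basisVec, map_smul, shift_basisVec, Int.cast_mul, Int.cast_natCast,
      alpha_apply_mul]
  · rw [star_shift_basisVec_of_not_dvd hl, map_zero, map_zero,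
      alpha_apply_of_not_dvd f (mt (dvd_intCast_iff l).mp hl), zero_smul]

variable (s) in
/-- The covariant pair of the `s`-adic shift and the multiplication operators. -/
def concretePair : CovariantPair (alpha s) (concreteAlgebra s) where
  M :=
    { toFun := fun f => ⟨mulOp f, mulOp_mem s f⟩
      map_one' := Subtype.ext (ContinuousLinearMap.ext fun _ => lp.ext (funext fun _ => one_mul _))
      map_mul' := fun _ _ => Subtype.ext (ContinuousLinearMap.ext fun _ =>
        lp.ext (funext fun _ => mul_assoc _ _ _))
      map_zero' := Subtype.ext (ContinuousLinearMap.ext fun _ =>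
        lp.ext (funext fun _ => zero_mul _))
      map_add' := fun _ _ => Subtype.ext (ContinuousLinearMap.ext fun _ =>
        lp.ext (funext fun _ => add_mul _ _ _))
      commutes' := fun _ => Subtype.ext (ContinuousLinearMap.ext fun _ =>
        lp.ext (funext fun _ => rfl))
      map_star' := fun f => Subtype.ext (mulOp_star f) }
  V := ⟨shift s, shift_mem s⟩
  isometry := Subtype.ext star_shift_mul_shift
  covariant f := Subtype.ext (mulOp_alpha f)

/-- A continuous function on `ℤ_s` is bounded by its values at the non-zero integers. -/
theorem norm_le_of_intCast {f : C(SAdicInt s, ℂ)} {c : ℝ} (hc : 0 ≤ c)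
    (h : ∀ l : ℤ, l ≠ 0 → ‖f (l : SAdicInt s)‖ ≤ c) : ‖f‖ ≤ c := by
  refine (ContinuousMap.norm_le f hc).mpr fun x => ?_
  -- Adding `s ^ n` leaves the coordinates up to level `n` unchanged and keeps the approximating
  -- integer away from `0`.
  let l : ℕ → ℤ := fun n => ((x.1 n).val + s ^ n : ℕ)
  have hl : ∀ n, l n ≠ 0 := fun n => by
    have := pow_pos (NeZero.pos s) n
    exact Int.natCast_ne_zero.mpr (by omega)
  have hval : ∀ k n, k ≤ n → (x.1 n).val % s ^ k = (x.1 k).val := fun k n hkn => by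
    induction n, hkn using Nat.le_induction with
    | base => exact Nat.mod_eq_of_lt (ZMod.val_lt _)
    | succ n hkn ih =>
      rw [← ih, ← val_succ_mod x n, Nat.mod_mod_of_dvd _ (pow_dvd_pow s hkn)]
  have hx : Filter.Tendsto (fun n => (l n : SAdicInt s)) Filter.atTop (nhds x) := by
    refine tendsto_subtype_rng.mpr (tendsto_pi_nhds.mpr fun k => ?_)
    refine tendsto_const_nhds.congr' ?_
    filter_upwards [Filter.eventually_ge_atTop k] with n hn
    change x.1 k = ((l n : ℤ) : ZMod (s ^ k))
    rw [Int.cast_natCast, Nat.cast_add, (ZMod.natCast_eq_zero_iff _ _).mpr (pow_dvd_pow s hn),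
      add_zero, ← ZMod.natCast_mod, hval k n hn, ZMod.natCast_zmod_val]
  exact le_of_tendsto (((f.continuous.tendsto x).comp hx).norm)
    (Filter.Eventually.of_forall fun n => h (l n) (hl n))

theorem shift_pow_basisVec (n : ℕ) (l : ℤ) :
    (shift s ^ n) (basisVec l) = basisVec (s ^ n * l) := by
  induction n with
  | zero => simp
  | succ n ih =>
    rw [pow_succ', mul_apply_eq_comp, ih, shift_basisVec, pow_succ', mul_assoc]

/-- Here `2 ≤ s` is essential: it gives `s ^ n * l ≠ l`, so `V ^ n` has no diagonal coefficient away
from `l = 0`. -/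
theorem inner_shift_pow_basisVec (hs : 2 ≤ s) {l : ℤ} (hl : l ≠ 0) {n : ℕ} (hn : 0 < n) :
    inner ℂ (basisVec l) ((shift s ^ n) (basisVec l)) = 0 := by
  rw [shift_pow_basisVec, orthonormal_basisVec.2]
  intro h
  have h1 : (s : ℤ) ^ n = 1 := by
    refine mul_right_cancel₀ hl ?_
    rw [one_mul, ← h]
  have h2 : s ^ n = 1 := by exact_mod_cast h1
  have h3 := Nat.one_lt_pow hn.ne' hs
  omega

end SAdicInt

end

noncomputable section

/-! ### Words in a covariant pair. -/

namespace SAdicInt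

variable {s : ℕ} [NeZero s]

/-- The endomorphism `f ↦ f (s ·)` of `C(ℤ_s)`, a left inverse of `α`. -/
def mulBase (f : C(SAdicInt s, ℂ)) : C(SAdicInt s, ℂ) :=
  f.comp ⟨fun x => (s : SAdicInt s) * x, continuous_const.mul continuous_id⟩

/-- The function `α 1` is the indicator of the multiples of `s`, so this says that the range of `α`
is an ideal. -/
theorem alpha_mulBase (f : C(SAdicInt s, ℂ)) : alpha s (mulBase f) = alpha s 1 * f := by
  ext x
  rw [ContinuousMap.mul_apply]
  by_cases hx : (s : SAdicInt s) ∣ x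
  · obtain ⟨y, rfl⟩ := hx
    simp only [alpha_apply_mul, ContinuousMap.one_apply, one_mul]
    rfl
  · simp only [alpha_apply_of_not_dvd _ hx, zero_mul]

section Words

variable {B : Type*} [CStarAlgebra B] (P : CovariantPair (alpha s) B)

theorem V_mul_M (f : C(SAdicInt s, ℂ)) : P.V * P.M f = P.M (alpha s f) * P.V := by
  rw [P.covariant, mul_assoc, P.isometry, mul_one]

theorem M_mul_star_V (f : C(SAdicInt s, ℂ)) :
    P.M f * star P.V = star P.V * P.M (alpha s f) := by
  rw [P.covariant, ← mul_assoc, ← mul_assoc, P.isometry, one_mul]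

theorem M_alpha_one : P.M (alpha s 1) = P.V * star P.V := by
  rw [P.covariant, map_one, mul_one]

theorem star_V_mul_M_mul_V (f : C(SAdicInt s, ℂ)) :
    star P.V * P.M f * P.V = P.M (mulBase f) := by
  have h : P.V * P.M (mulBase f) * star P.V = P.V * star P.V * P.M f := by
    rw [← P.covariant, alpha_mulBase, map_mul, M_alpha_one]
  -- Insert `V⋆ = V⋆ (V V⋆)`, so that the range projection `V V⋆ = M (α 1)` meets `M f`.
  calc star P.V * P.M f * P.V = star P.V * (P.V * star P.V * P.M f) * P.V := by
        simp only [← mul_assoc, P.isometry, one_mul]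
    _ = (star P.V * P.V) * P.M (mulBase f) * (star P.V * P.V) := by
        rw [← h]; simp only [mul_assoc]
    _ = _ := by rw [P.isometry, one_mul, mul_one]

theorem M_mul_star_V_pow (f : C(SAdicInt s, ℂ)) (n : ℕ) :
    P.M f * star P.V ^ n = star P.V ^ n * P.M ((alpha s)^[n] f) := by
  induction n generalizing f with
  | zero => simp
  | succ n ih =>
    rw [pow_succ', ← mul_assoc, M_mul_star_V, mul_assoc, ih, ← mul_assoc]
    rfl

/-- The words `M_f V ^ n` and `V⋆ ^ n M_f` in a covariant pair. -/
def words : Set B :=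
  {w | ∃ n f, w = P.M f * P.V ^ n ∨ w = star P.V ^ n * P.M f}

theorem M_mul_mem_words (g : C(SAdicInt s, ℂ)) {w : B} (hw : w ∈ words P) :
    P.M g * w ∈ words P := by
  obtain ⟨n, f, rfl | rfl⟩ := hw
  · exact ⟨n, g * f, .inl (by rw [map_mul, mul_assoc])⟩
  · exact ⟨n, (alpha s)^[n] g * f, .inr (by
      rw [← mul_assoc, M_mul_star_V_pow, mul_assoc, map_mul])⟩

/-- When `V` meets a positive power of `V⋆`, the product `V V⋆` is the function `M (α 1)`, which is
absorbed by `M_mul_mem_words`. -/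
theorem V_mul_mem_words {w : B} (hw : w ∈ words P) : P.V * w ∈ words P := by
  obtain ⟨n, f, rfl | rfl⟩ := hw
  · exact ⟨n + 1, alpha s f, .inl (by rw [← mul_assoc, V_mul_M, mul_assoc, pow_succ'])⟩
  · cases n with
    | zero => exact ⟨1, alpha s f, .inl (by rw [pow_zero, one_mul, pow_one, V_mul_M])⟩
    | succ n =>
      rw [pow_succ', ← mul_assoc, ← mul_assoc, ← M_alpha_one, mul_assoc]
      exact M_mul_mem_words P _ ⟨n, f, .inr rfl⟩

theorem star_V_mul_mem_words {w : B} (hw : w ∈ words P) : star P.V * w ∈ words P := by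
  obtain ⟨n, f, rfl | rfl⟩ := hw
  · cases n with
    | zero => exact ⟨1, f, .inr (by rw [pow_zero, mul_one, pow_one])⟩
    | succ n =>
      exact ⟨n, mulBase f, .inl (by
        rw [pow_succ', ← star_V_mul_M_mul_V]; simp only [mul_assoc])⟩
  · exact ⟨n + 1, f, .inr (by rw [← mul_assoc, pow_succ'])⟩

end Words

/-- Left multiplication by `a` preserves the closed span `T` if it maps the spanning set into it. -/
theorem mul_mem_topologicalClosure_span {B : Type*} [CStarAlgebra B] {W : Set B} {a : B}
    (h : ∀ w ∈ W, a * w ∈ W) {d : B} (hd : d ∈ (Submodule.span ℂ W).topologicalClosure) :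
    a * d ∈ (Submodule.span ℂ W).topologicalClosure := by
  refine map_mem_closure (continuous_const_mul a) hd fun d hd => ?_
  have hle : Submodule.span ℂ W ≤ (Submodule.span ℂ W).comap (LinearMap.mulLeft ℂ a) :=
    Submodule.span_le.mpr fun w hw => Submodule.subset_span (h w hw)
  exact hle hd

/-- The words in the canonical pair span a dense subspace of the Hensel-Steinitz algebra. -/
theorem mem_closure_span_words (x : HenselSteinitz s) :
    x ∈ (Submodule.span ℂ (words (CrossedProduct.pair (alpha s)))).topologicalClosure := by
  set P := CrossedProduct.pair (alpha s) with hP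
  set T := (Submodule.span ℂ (words P)).topologicalClosure with hT
  -- Taking the `a` for which both `a` and `star a` multiply `T` into itself makes this a
  -- `⋆`-subalgebra without any product of two words being computed. Applying such an `a` to `1 ∈ T`
  -- gives `a ∈ T`.
  let S : StarSubalgebra ℂ (HenselSteinitz s) :=
    { carrier := {a | ∀ d ∈ T, a * d ∈ T ∧ star a * d ∈ T}
      mul_mem' := fun {a b} ha hb d hd => by
        rw [star_mul, mul_assoc, mul_assoc]
        exact ⟨(ha _ (hb d hd).1).1, (hb _ (ha d hd).2).2⟩
      add_mem' := fun {a b} ha hb d hd => by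
        rw [star_add, add_mul, add_mul]
        exact ⟨T.add_mem (ha d hd).1 (hb d hd).1, T.add_mem (ha d hd).2 (hb d hd).2⟩
      algebraMap_mem' := fun c d hd => by
        rw [Algebra.algebraMap_eq_smul_one, star_smul, star_one, smul_mul_assoc, smul_mul_assoc,
          one_mul]
        exact ⟨T.smul_mem _ hd, T.smul_mem _ hd⟩
      star_mem' := fun {a} ha d hd => by
        rw [star_star]
        exact (ha d hd).symm }
  have hS : IsClosed (S : Set (HenselSteinitz s)) := by
    have hTc : IsClosed (T : Set (HenselSteinitz s)) := Submodule.isClosed_topologicalClosure _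
    have : (S : Set (HenselSteinitz s)) =
        ⋂ d ∈ T, {a | a * d ∈ T} ∩ {a | star a * d ∈ T} := by
      ext a
      simp only [Set.mem_iInter]
      rfl
    rw [this]
    refine isClosed_biInter fun d _ => ?_
    exact (hTc.preimage (continuous_mul_const d)).inter
      (hTc.preimage ((continuous_mul_const d).comp continuous_star))
  have hx : x ∈ S := by
    refine CrossedProduct.mem_of_isClosed S hS (fun f d hd => ⟨?_, ?_⟩) (fun d hd => ⟨?_, ?_⟩) x
    · exact mul_mem_topologicalClosure_span (fun w => M_mul_mem_words P f) hd
    · rw [← map_star]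
      exact mul_mem_topologicalClosure_span (fun w => M_mul_mem_words P (star f)) hd
    · exact mul_mem_topologicalClosure_span (fun w => V_mul_mem_words P) hd
    · exact mul_mem_topologicalClosure_span (fun w => star_V_mul_mem_words P) hd
  have h1 : (1 : HenselSteinitz s) ∈ T :=
    Submodule.le_topologicalClosure _ (Submodule.subset_span ⟨0, 1, .inl (by simp)⟩)
  have h := (hx 1 h1).1
  rwa [mul_one] at h

/-! ### Faithfulness of the representation on `ℓ²(ℤ)`. -/

variable (s) in
/-- The representation of the Hensel-Steinitz algebra on `ℓ²(ℤ)`. -/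
def toConcrete : HenselSteinitz s →⋆ₐ[ℂ] concreteAlgebra s :=
  (CrossedProduct.existsUnique_hom (concretePair s)).choose

theorem toConcrete_M (f : C(SAdicInt s, ℂ)) :
    (toConcrete s ((CrossedProduct.pair (alpha s)).M f) : ellTwo →L[ℂ] ellTwo) = mulOp f :=
  congrArg Subtype.val ((CrossedProduct.existsUnique_hom (concretePair s)).choose_spec.1.1 f)

theorem toConcrete_V :
    (toConcrete s (CrossedProduct.pair (alpha s)).V : ellTwo →L[ℂ] ellTwo) = shift s :=
  congrArg Subtype.val (CrossedProduct.existsUnique_hom (concretePair s)).choose_spec.1.2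

variable (s) in
/-- The representation of the Hensel-Steinitz algebra by all bounded operators on `ℓ²(ℤ)`. -/
def toOperator : HenselSteinitz s →⋆ₐ[ℂ] (ellTwo →L[ℂ] ellTwo) :=
  (concreteAlgebra s).subtype.comp (toConcrete s)

theorem toOperator_M (f : C(SAdicInt s, ℂ)) :
    toOperator s ((CrossedProduct.pair (alpha s)).M f) = mulOp f := toConcrete_M f

theorem toOperator_V : toOperator s (CrossedProduct.pair (alpha s)).V = shift s := toConcrete_V

/-- On the span of the words, the gauge means are eventually the image of a function on `ℤ_s`, whose
values at the non-zero integers are diagonal matrix coefficients. -/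
theorem exists_gaugeMean_eq (hs : 2 ≤ s) {y : HenselSteinitz s}
    (hy : y ∈ Submodule.span ℂ (words (CrossedProduct.pair (alpha s)))) :
    ∃ (f : C(SAdicInt s, ℂ)) (N₀ : ℕ),
      (∀ N > N₀, CrossedProduct.gaugeMean N y = (CrossedProduct.pair (alpha s)).M f) ∧
      ∀ l : ℤ, l ≠ 0 →
        inner ℂ (basisVec l) (toOperator s y (basisVec l)) = f (l : SAdicInt s) := by
  induction hy using Submodule.span_induction with
  | zero => exact ⟨0, 0, fun N _ => by simp, fun l _ => by simp⟩
  | add y z _ _ hy hz =>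
    obtain ⟨f, N₀, hf, hf'⟩ := hy
    obtain ⟨g, N₁, hg, hg'⟩ := hz
    refine ⟨f + g, max N₀ N₁, fun N hN => ?_, fun l hl => ?_⟩
    · rw [map_add, map_add, hf N (lt_of_le_of_lt (le_max_left _ _) hN),
        hg N (lt_of_le_of_lt (le_max_right _ _) hN)]
    · rw [map_add, add_apply, inner_add_right, hf' l hl, hg' l hl,
        ContinuousMap.add_apply]
  | smul c y _ hy =>
    obtain ⟨f, N₀, hf, hf'⟩ := hy
    refine ⟨c • f, N₀, fun N hN => ?_, fun l hl => ?_⟩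
    · rw [map_smul, map_smul, hf N hN]
    · rw [map_smul, smul_apply, inner_smul_right, hf' l hl, ContinuousMap.smul_apply, smul_eq_mul]
  | mem w hw =>
    have hgauge : ∀ (f : C(SAdicInt s, ℂ)) (n : ℕ) (z : Circle),
        CrossedProduct.gauge z ((CrossedProduct.pair (alpha s)).M f *
          (CrossedProduct.pair (alpha s)).V ^ n) =
        (z : ℂ) ^ n • ((CrossedProduct.pair (alpha s)).M f *
          (CrossedProduct.pair (alpha s)).V ^ n) := fun f n z => by
      rw [map_mul, map_pow, CrossedProduct.gauge_M, CrossedProduct.gauge_V, smul_pow,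
        mul_smul_comm]
    obtain ⟨n, f, hw⟩ := hw
    rcases n.eq_zero_or_pos with rfl | hn
    · have hwf : w = (CrossedProduct.pair (alpha s)).M f := by simpa using hw
      -- The condition `N > 0` is needed, as the mean for `N = 0` is zero.
      refine ⟨f, 0, fun N hN => ?_, fun l _ => ?_⟩
      · rw [hwf, CrossedProduct.gaugeMean_eq_self hN fun z => CrossedProduct.gauge_M z f]
      · rw [hwf, toOperator_M, mulOp_basisVec, inner_smul_right, inner_self_eq_norm_sq_to_K,
          orthonormal_basisVec.1 l]
        simp
    · refine ⟨0, n, fun N hN => ?_, fun l hl => ?_⟩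
      · rw [map_zero]
        rcases hw with rfl | rfl
        · exact CrossedProduct.gaugeMean_eq_zero hn hN (hgauge f n)
        -- The word `V⋆ ^ n M_f` is the adjoint of `M_(star f) V ^ n`, whose mean vanishes.
        · rw [← star_star (_ * _), star_mul, star_pow, star_star, ← map_star,
            CrossedProduct.gaugeMean_star,
            CrossedProduct.gaugeMean_eq_zero hn hN (hgauge (star f) n), star_zero]
      · rw [ContinuousMap.zero_apply]
        rcases hw with rfl | rfl
        · rw [map_mul, map_pow, toOperator_M, toOperator_V, mul_apply_eq_comp, shift_pow_basisVec,
            mulOp_basisVec, inner_smul_right, ← shift_pow_basisVec,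
            inner_shift_pow_basisVec hs hl hn, mul_zero]
        · rw [map_mul, map_pow, map_star, toOperator_M, toOperator_V, mul_apply_eq_comp,
            mulOp_basisVec, map_smul, inner_smul_right, ← star_pow,
            ContinuousLinearMap.star_eq_adjoint, ContinuousLinearMap.adjoint_inner_right,
            ← inner_conj_symm, inner_shift_pow_basisVec hs hl hn, map_zero, mul_zero]

theorem norm_inner_basisVec_le (T : ellTwo →L[ℂ] ellTwo) (l : ℤ) :
    ‖inner ℂ (basisVec l) (T (basisVec l))‖ ≤ ‖T‖ := by
  have h1 := orthonormal_basisVec.1 l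
  have h := (norm_inner_le_norm (𝕜 := ℂ) (basisVec l) (T (basisVec l))).trans
    (mul_le_mul_of_nonneg_left (T.le_opNorm (basisVec l)) (norm_nonneg _))
  rwa [h1, one_mul, mul_one] at h

/-- The representation of the Hensel-Steinitz algebra on `ℓ²(ℤ)` is faithful. -/
theorem toOperator_injective (hs : 2 ≤ s) : Function.Injective (toOperator s) := by
  refine (injective_iff_map_eq_zero _).mpr fun x hx => ?_
  obtain ⟨m, hm, hlow⟩ := CrossedProduct.exists_norm_le_gaugeMean_star_mul_self x
  set y := star x * x with hy
  have hy0 : toOperator s y = 0 := by rw [hy, map_mul, hx, mul_zero]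
  have hm0 : (0 : ℝ) < m := Nat.cast_pos.mpr hm
  by_contra hx0
  have hypos : 0 < ‖y‖ := norm_pos_iff.mpr (mt (CStarRing.star_mul_self_eq_zero_iff x).mp hx0)
  -- The mean of `y` will be bounded by two errors of this size. Multiplied by `m` they give `‖y‖ /
  -- 4`, below the lower bound `‖y‖ / 2`.
  obtain ⟨y', hy', hdist⟩ := Metric.mem_closure_iff.mp (mem_closure_span_words y)
    (‖y‖ / (8 * m)) (by positivity)
  rw [dist_eq_norm] at hdist
  obtain ⟨f, N₀, hf, hdiag⟩ := exists_gaugeMean_eq hs hy'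
  have hop : ‖toOperator s y'‖ ≤ ‖y - y'‖ := by
    have h := NonUnitalStarAlgHom.norm_apply_le (toOperator s) (y - y')
    rwa [map_sub, hy0, zero_sub, norm_neg] at h
  have hfn : ‖f‖ ≤ ‖y - y'‖ := by
    refine norm_le_of_intCast (norm_nonneg _) fun l hl => ?_
    rw [← hdiag l hl]
    exact (norm_inner_basisVec_le _ l).trans hop
  -- The lower bound concerns multiples of `m`; `K = N₀ + 1` is a choice that takes `m * K` past
  -- `N₀`.
  have hN : N₀ < m * (N₀ + 1) := (Nat.lt_succ_self N₀).trans_le (Nat.le_mul_of_pos_left _ hm)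
  have h1 : ‖CrossedProduct.gaugeMean (m * (N₀ + 1)) y'‖ ≤ ‖y - y'‖ := by
    rw [hf _ hN]
    exact (NonUnitalStarAlgHom.norm_apply_le _ f).trans hfn
  have h2 := CrossedProduct.norm_gaugeMean_le (m * (N₀ + 1)) (y - y')
  have h3 : ‖CrossedProduct.gaugeMean (m * (N₀ + 1)) y‖ ≤ 2 * (‖y‖ / (8 * m)) := by
    rw [map_sub] at h2
    have h4 := norm_sub_norm_le (CrossedProduct.gaugeMean (m * (N₀ + 1)) y)
      (CrossedProduct.gaugeMean (m * (N₀ + 1)) y')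
    linarith
  have h5 := (hlow (N₀ + 1) N₀.succ_pos).trans (mul_le_mul_of_nonneg_left h3 hm0.le)
  have h6 : m * (2 * (‖y‖ / (8 * m))) = ‖y‖ / 4 := by
    field_simp
    norm_num
  linarith

/-- An injective `⋆`-homomorphism of C⋆-algebras is isometric, so its range is closed. Containing
the generators, it contains the whole concrete algebra. -/
theorem toConcrete_bijective (hs : 2 ≤ s) : Function.Bijective (toConcrete s) := by
  have hinj := toOperator_injective hs
  refine ⟨fun x y h => hinj (congrArg Subtype.val h), fun T => ?_⟩
  have hclosed : IsClosed ((toOperator s).range : Set (ellTwo →L[ℂ] ellTwo)) :=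
    (NonUnitalStarAlgHom.isometry (toOperator s) hinj).isClosedEmbedding.isClosed_range
  have hle : concreteAlgebra s ≤ (toOperator s).range := by
    refine StarSubalgebra.topologicalClosure_minimal (StarAlgebra.adjoin_le ?_) hclosed
    rintro _ (rfl | ⟨f, rfl⟩)
    · exact ⟨_, toOperator_V⟩
    · exact ⟨_, toOperator_M f⟩
  obtain ⟨x, hx⟩ := hle T.2
  exact ⟨x, Subtype.ext hx⟩

end SAdicInt

end

theorem mainTheorem1 (s : ℕ) [NeZero s] (hs : 2 ≤ s) :
    ∃ Φ : SAdicInt.HenselSteinitz s ≃⋆ₐ[ℂ] SAdicInt.concreteAlgebra s,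
      (Φ (CrossedProduct.pair (SAdicInt.alpha s)).V : SAdicInt.ellTwo →L[ℂ] SAdicInt.ellTwo) =
          SAdicInt.shift s ∧
        ∀ f : C(SAdicInt s, ℂ),
          (Φ ((CrossedProduct.pair (SAdicInt.alpha s)).M f) :
            SAdicInt.ellTwo →L[ℂ] SAdicInt.ellTwo) = SAdicInt.mulOp f :=
  ⟨StarAlgEquiv.ofBijective (SAdicInt.toConcrete s) (SAdicInt.toConcrete_bijective hs),
    SAdicInt.toConcrete_V, SAdicInt.toConcrete_M⟩
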